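/- Let $C$ be a real symmetric positive semidefinite matrix of order $n$, let $0<s<n$ be an integer, let $A\in\mathbb{R}^{m\times n}$ and $b\in\mathbb{R}^m$. Let $\mathbf e$ be the all-ones vector, $\circ$ the entrywise product of matrices, and $\mathbb{S}^n$ the space of real symmetric matrices of order $n$. Let $\log 0:=-\infty$ and let the maximum of the empty set be $-\infty$. Define $$z(C,s,A,b):=\max\{\log\det C[S(x),S(x)] : \mathbf e^\top x=s,\ x\in\{0,1\}^n,\ Ax\le b\},$$ where $S(x)$ is the support of $x$ and $C[S,S]$ is the principal submatrix of $C$ indexed by $S$, and $$P(n,s):=\{(x,X)\in\mathbb{R}^n\times\mathbb{S}^n : X-xx^\top\succeq0,\ \mathrm{diag}(X)=x,\ \mathbf e^\top x=s,\ X\mathbf e=sx\}.$$ For $\Upsilon=(\gamma_1,\dots,\gamma_n)\in\mathbb{R}^n_{++}$ (all $\gamma_i>0$) let $$F(x,X;\Upsilon):=(\mathrm{Diag}(\Upsilon)\,C\,\mathrm{Diag}(\Upsilon))\circ X+\mathrm{Diag}(\mathbf e-x),\qquad \mathrm{dom}(f_{BQP};\Upsilon):=\{(x,X)\in\mathbb{R}^n\times\mathbb{S}^n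 : F(x,X;\Upsilon)\succ0\},$$ $$f_{BQP}(x,X;\Upsilon):=\log\det F(x,X;\Upsilon)-2\sum_{i=1}^n x_i\log\gamma_i ,$$ $$z_{BQP}(\Upsilon):=\max\{f_{BQP}(x,X;\Upsilon) : (x,X)\in P(n,s),\ Ax\le b\}.$$ (For $(x,X)\in P(n,s)$ the matrix $F(x,X;\Upsilon)$ is positive semidefinite, and the objective is $-\infty$ outside $\mathrm{dom}(f_{BQP};\Upsilon)$.) For all $\Upsilon\in\mathbb{R}^n_{++}$ the maximum defining $z_{BQP}(\Upsilon)$ is attained whenever some feasible point lies in $\mathrm{dom}(f_{BQP};\Upsilon)$, and the following hold. (i) $z(C,s,A,b)\le z_{BQP}(\Upsilon)$. (ii) $\mathrm{dom}(f_{BQP};\Upsilon)$ is convex and $f_{BQP}(x,X;\Upsilon)$ is concave in $(x,X)$ on it. The set of all $(x,X,\Upsilon)$ with $\Upsilon\in\mathbb{R}^n_{++}$ and $(x,X)\in\mathrm{dom}(f_{BQP};\Upsilon)$ is open in $\mathbb{R}^n\times\mathbb{S}^n\times\mathbb{R}^n$, and $f_{BQP}$ is continuously differentiable in $(x,X,\Upsilon)$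 on it. (iii) For each fixed $(x,X)\in\mathrm{dom}(f_{BQP};\Upsilon)$ with $0\le x\le\mathbf e$ and $X\succeq0$ (in particular for each $(x,X)\in P(n,s)\cap\mathrm{dom}(f_{BQP};\Upsilon)$), the point $(x,X)$ lies in $\mathrm{dom}(f_{BQP};\Upsilon')$ for every $\Upsilon'\in\mathbb{R}^n_{++}$, and $f_{BQP}(x,X;\Upsilon')$ is a convex function of $\log\Upsilon'\in\mathbb{R}^n$ (componentwise logarithm). Moreover $z_{BQP}$ is convex in $\log\Upsilon$: it is either identically $-\infty$ or real-valued and convex as a function of $\log\Upsilon\in\mathbb{R}^n$. -/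

import Mathlib

open Matrix

/- Norm on real matrices (entrywise sup norm). All norms on this finite-dimensional space are
equivalent, so continuous differentiability does not depend on the choice. -/
attribute [local instance] Matrix.normedAddCommGroup Matrix.normedSpace

namespace CMESP

/-- The space `𝕊ⁿ` of real symmetric matrices of order `n`. -/
def SymMat (n : ℕ) : Submodule ℝ (Matrix (Fin n) (Fin n) ℝ) where
  carrier := {X | X.IsSymm}
  add_mem' := fun hX hY => hX.add hY
  zero_mem' := Matrix.isSymm_zero
  smul_mem' := fun c _ hX => hX.smul c

/-- The support `S(x)` of a vector. -/
noncomputable def supp {n : ℕ} (x : Fin n → ℝ) : Finset (Fin n) :=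
  Finset.univ.filter fun i => x i ≠ 0

/-- The principal submatrix `C[S,S]`. -/
def principal {n : ℕ} (C : Matrix (Fin n) (Fin n) ℝ) (S : Finset (Fin n)) :
    Matrix S S ℝ :=
  C.submatrix (fun i => (i : Fin n)) (fun i => (i : Fin n))

/-- Feasible points of the constrained maximum-entropy sampling problem:
`x ∈ {0,1}ⁿ`, `eᵀx = s`, `A x ≤ b`. -/
def cmespFeasible {n m : ℕ} (s : ℕ) (A : Matrix (Fin m) (Fin n) ℝ) (b : Fin m → ℝ) :
    Set (Fin n → ℝ) :=
  {x | (∀ i, x i = 0 ∨ x i = 1) ∧ ∑ i, x i = (s : ℝ) ∧ A *ᵥ x ≤ b}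

/-- The optimal value `z(C,s,A,b)`, as an extended real. For positive semidefinite `C`, a feasible
point with singular `C[S(x),S(x)]` has objective value `log 0 = -∞`, so it does not contribute to
the supremum; the value is `-∞` when no feasible point has a finite objective value. -/
noncomputable def z {n m : ℕ} (C : Matrix (Fin n) (Fin n) ℝ) (s : ℕ)
    (A : Matrix (Fin m) (Fin n) ℝ) (b : Fin m → ℝ) : EReal :=
  ⨆ x ∈ {x ∈ cmespFeasible s A b | (principal C (supp x)).PosDef},
    ((Real.log (principal C (supp x)).det : ℝ) : EReal)

/-- The convex set `P(n,s)`: pairs `(x,X) ∈ ℝⁿ × 𝕊ⁿ` with `X - xxᵀ ⪰ 0`, `diag X = x`,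
`eᵀx = s`, `X e = s x`. -/
def P (n s : ℕ) : Set ((Fin n → ℝ) × SymMat n) :=
  {p | ((p.2 : Matrix (Fin n) (Fin n) ℝ) - vecMulVec p.1 p.1).PosSemidef ∧
    diag (p.2 : Matrix (Fin n) (Fin n) ℝ) = p.1 ∧
    ∑ i, p.1 i = (s : ℝ) ∧
    (p.2 : Matrix (Fin n) (Fin n) ℝ) *ᵥ (fun _ => 1) = (s : ℝ) • p.1}

/-- The matrix `(Diag(Υ) C Diag(Υ)) ∘ X + Diag(e - x)`. -/
def FBQP {n : ℕ} (C : Matrix (Fin n) (Fin n) ℝ) (Υ : Fin n → ℝ)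
    (p : (Fin n → ℝ) × SymMat n) : Matrix (Fin n) (Fin n) ℝ :=
  (diagonal Υ * C * diagonal Υ) ⊙ (p.2 : Matrix (Fin n) (Fin n) ℝ) +
    diagonal (fun i => 1 - p.1 i)

/-- The function `f_BQP(x,X;Υ)`; its value is meaningful on `domBQP C Υ`, where the determinant is
positive. -/
noncomputable def fBQP {n : ℕ} (C : Matrix (Fin n) (Fin n) ℝ) (Υ : Fin n → ℝ)
    (p : (Fin n → ℝ) × SymMat n) : ℝ :=
  Real.log (FBQP C Υ p).det - 2 * ∑ i, p.1 i * Real.log (Υ i)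

/-- The domain `dom(f_BQP; Υ)`. -/
def domBQP {n : ℕ} (C : Matrix (Fin n) (Fin n) ℝ) (Υ : Fin n → ℝ) :
    Set ((Fin n → ℝ) × SymMat n) :=
  {p | (FBQP C Υ p).PosDef}

/-- Feasible points of the BQP relaxation: `(x,X) ∈ P(n,s)`, `A x ≤ b`. -/
def bqpFeasible {n m : ℕ} (s : ℕ) (A : Matrix (Fin m) (Fin n) ℝ) (b : Fin m → ℝ) :
    Set ((Fin n → ℝ) × SymMat n) :=
  {p ∈ P n s | A *ᵥ p.1 ≤ b}

/-- The g-scaled BQP bound `z_BQP(Υ)`, as an extended real. For positive semidefinite `C`, the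
matrix `FBQP C Υ p` is positive semidefinite at every feasible `p`, and a feasible point outside the
domain has objective value `-∞`, so it does not contribute to the supremum. -/
noncomputable def zBQP {n m : ℕ} (C : Matrix (Fin n) (Fin n) ℝ) (s : ℕ)
    (A : Matrix (Fin m) (Fin n) ℝ) (b : Fin m → ℝ) (Υ : Fin n → ℝ) : EReal :=
  ⨆ p ∈ bqpFeasible s A b ∩ domBQP C Υ, ((fBQP C Υ p : ℝ) : EReal)

/-- Componentwise exponential; `Υ = expVec ψ` means `ψ = log Υ`. -/
noncomputable def expVec {n : ℕ} (ψ : Fin n → ℝ) : Fin n → ℝ := fun i => Real.exp (ψ i)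

end CMESP

/-!
Writing `D = Diag Υ`, the matrix in the objective is `F = D (C ∘ X) D + Diag (e - x)`, where `C ∘ X`
is positive semidefinite by the Schur product theorem whenever `X` is.

* Attainment: the feasible set is compact, since `diag X = x` and `X - x xᵀ ⪰ 0` force
  `0 ≤ x ≤ e` and `|X i j| ≤ 1`. On it `F` is positive semidefinite, so `F` is positive definite
  exactly where `det F > 0`, and a maximizer of the continuous function
  `det F * exp (-2 ∑ x i log γ i)` maximizes the objective (`exists_isMaxOn_fBQP`).
* Upper bound: a binary point `x` is lifted to `(x, x xᵀ)`, where `F` splits into the block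
  `(D C D)[S(x), S(x)]` and an identity; the factor `∏ γ i ^ 2` cancels (`z_le_zBQP`).
* Concavity in `(x, X)`: `F` is affine in `(x, X)`, and `log det` is concave because it lies below
  its tangents, which reduces to `log μ ≤ μ - 1` for eigenvalues (`concaveOn_log_det`).
* Smoothness: `det F` is a polynomial, and positive definiteness is an open condition among
  symmetric matrices because it need only be tested on the compact unit sphere.
* Convexity in `log Υ`: expanding by rows,
  `det F = ∑ S, det (C ∘ X)[S, S] * ∏ i ∉ S, (1 - x i) * exp (2 ∑ i ∈ S, log γ i)`, with nonnegative
  coefficients (`det_add_diagonal`, `det_FBQP_expVec`), so `log det F` is a log-sum-exp function,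
  hence convex (`convexOn_log_sum_exp`). Since the domain within the feasible set is the same for
  every scaling (`mem_domBQP_of_mem`), the bound is a pointwise maximum of convex functions.
-/

/-! ### Log-determinant of positive definite matrices -/

namespace Matrix

variable {ι : Type*} [Fintype ι]

lemma PosSemidef.exists_eq_transpose_mul_self {M : Matrix ι ι ℝ} (hM : M.PosSemidef) :
    ∃ R : Matrix ι ι ℝ, M = Rᵀ * R := by
  classical
  open scoped MatrixOrder Matrix.Norms.L2Operator in
  obtain ⟨R, hR⟩ := CStarAlgebra.nonneg_iff_eq_star_mul_self.mp hM.nonneg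
  exact ⟨R, by simpa [star_eq_conjTranspose] using hR⟩

lemma PosSemidef.zero_le_dotProduct_mulVec {M : Matrix ι ι ℝ} (hM : M.PosSemidef) (v : ι → ℝ) :
    0 ≤ v ⬝ᵥ M *ᵥ v := by
  simpa using hM.dotProduct_mulVec_nonneg v

lemma PosSemidef.abs_apply_le_one {M : Matrix ι ι ℝ} (hM : M.PosSemidef)
    (hd : ∀ i, M i i ≤ 1) (i j : ι) : |M i j| ≤ 1 := by
  classical
  have hsymm : M j i = M i j := by simpa using hM.isHermitian.apply i j
  have h1 := hM.zero_le_dotProduct_mulVec (Pi.single i 1 + Pi.single j 1)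
  have h2 := hM.zero_le_dotProduct_mulVec (Pi.single i 1 - Pi.single j 1)
  simp only [mulVec_add, mulVec_sub, add_dotProduct, sub_dotProduct, dotProduct_add,
    dotProduct_sub, mulVec_single_one, single_one_dotProduct, col_apply, hsymm] at h1 h2
  rw [abs_le]
  constructor <;> linarith [hd i, hd j]

variable [DecidableEq ι]

lemma PosDef.log_det_le_trace_sub_card {M : Matrix ι ι ℝ} (hM : M.PosDef) :
    Real.log M.det ≤ M.trace - Fintype.card ι := by
  rw [hM.isHermitian.det_eq_prod_eigenvalues, hM.isHermitian.trace_eq_sum_eigenvalues]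
  simp only [RCLike.ofReal_real_eq_id, id]
  rw [Real.log_prod fun i _ => (hM.eigenvalues_pos i).ne']
  calc _ ≤ ∑ i, (hM.isHermitian.eigenvalues i - 1) :=
        Finset.sum_le_sum fun i _ => Real.log_le_sub_one_of_pos (hM.eigenvalues_pos i)
    _ = _ := by simp

/-- The tangent inequality for `log det` at `Q`; the linear term is the gradient `Q⁻¹`
paired with `M - Q`. -/
lemma PosDef.log_det_le_log_det_add_trace {Q M : Matrix ι ι ℝ} (hQ : Q.PosDef) (hM : M.PosDef) :
    Real.log M.det ≤ Real.log Q.det + ((Q⁻¹ * M).trace - Fintype.card ι) := by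
  obtain ⟨R, hR⟩ := hQ.inv.posSemidef.exists_eq_transpose_mul_self
  have hdet : Q⁻¹.det = R.det * R.det := by rw [hR, det_mul, det_transpose]
  have hQdet := hQ.inv.det_pos
  have hRunit : IsUnit R := by
    rw [isUnit_iff_isUnit_det, isUnit_iff_ne_zero]
    rintro h
    simp [hdet, h] at hQdet
  have hN : (R * M * Rᵀ).PosDef := by
    have := (IsUnit.posDef_star_right_conjugate_iff (x := M) hRunit).2 hM
    simpa [star_eq_conjTranspose] using this
  have h := hN.log_det_le_trace_sub_card
  have e1 : (R * M * Rᵀ).det = Q⁻¹.det * M.det := by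
    rw [det_mul, det_mul, det_transpose, hdet]; ring
  have e2 : (R * M * Rᵀ).trace = (Q⁻¹ * M).trace := by
    rw [trace_mul_comm, ← Matrix.mul_assoc, hR]
  rw [e1, e2, Real.log_mul hQdet.ne' hM.det_pos.ne', det_nonsing_inv, Ring.inverse_eq_inv',
    Real.log_inv] at h
  linarith

theorem concaveOn_log_det :
    ConcaveOn ℝ {M : Matrix ι ι ℝ | M.PosDef} fun M => Real.log M.det := by
  have hconv : Convex ℝ {M : Matrix ι ι ℝ | M.PosDef} :=
    convex_iff_forall_pos.2 fun _ hM _ hN a b ha hb _ => (hM.smul ha).add (hN.smul hb)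
  refine ⟨hconv, fun M hM N hN a b ha hb hab => ?_⟩
  have hQ := hconv hM hN ha hb hab
  set Q := a • M + b • N with hQdef
  have h1 := mul_le_mul_of_nonneg_left (PosDef.log_det_le_log_det_add_trace hQ hM) ha
  have h2 := mul_le_mul_of_nonneg_left (PosDef.log_det_le_log_det_add_trace hQ hN) hb
  have htr : a * (Q⁻¹ * M).trace + b * (Q⁻¹ * N).trace = Fintype.card ι := by
    have : (Q⁻¹ * Q).trace = Fintype.card ι := by
      rw [nonsing_inv_mul _ hQ.det_pos.ne'.isUnit, trace_one]
    rw [← this]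
    nth_rw 4 [hQdef]
    simp [Matrix.mul_add]
  have : a * Real.log Q.det + b * Real.log Q.det = Real.log Q.det := by rw [← add_mul, hab, one_mul]
  have : a * (Fintype.card ι : ℝ) + b * Fintype.card ι = Fintype.card ι := by
    rw [← add_mul, hab, one_mul]
  simp only [smul_eq_mul]
  linarith

/-! ### Expanding the determinant of a diagonal perturbation -/

/-- A matrix whose rows outside `S` are those of `diagonal d` is block triangular. -/
lemma det_eq_of_rows_diagonal {R : Type*} [CommRing R] (N : Matrix ι ι R) (d : ι → R)
    (S : Finset ι) (h : ∀ i ∉ S, ∀ j, N i j = diagonal d i j) :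
    N.det = (N.submatrix (Subtype.val : S → ι) Subtype.val).det * ∏ i ∈ Sᶜ, d i := by
  rw [twoBlockTriangular_det N (· ∈ S) fun i hi j hj => by
    rw [h i hi, diagonal_apply_ne _ (by rintro rfl; exact hi hj)]]
  have : toSquareBlockProp N (fun i => ¬ i ∈ S) = diagonal fun i => d i.1 := by
    ext i j
    simp [toSquareBlockProp_def, h i i.2, diagonal_apply, Subtype.ext_iff]
  rw [this, det_diagonal]
  -- The two determinants carry different `Fintype` instances on the subtype.
  exact congrArg₂ (· * ·) (by congr!) (Finset.prod_subtype Sᶜ (fun _ => Finset.mem_compl) d).symm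

lemma det_add_diagonal {R : Type*} [CommRing R] (M : Matrix ι ι R) (d : ι → R) :
    (M + diagonal d).det =
      ∑ S : Finset ι, (M.submatrix (Subtype.val : S → ι) Subtype.val).det * ∏ i ∈ Sᶜ, d i := by
  have h := (detRowAlternating (n := ι) (R := R)).toMultilinearMap.map_add_univ M (diagonal d)
  refine h.trans (Finset.sum_congr rfl fun S _ => ?_)
  have := det_eq_of_rows_diagonal (of (S.piecewise M (diagonal d))) d S fun i hi j =>
    congrFun (Finset.piecewise_eq_of_notMem S M (diagonal d) hi) j
  refine this.trans ?_
  congr 2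
  ext i j
  exact congrFun (Finset.piecewise_eq_of_mem S M (diagonal d) i.2) j

end Matrix

/-! ### Convexity of log-sum-exp -/

lemma convexOn_log_sum_exp {κ E : Type*} [AddCommGroup E] [Module ℝ E] (s : Finset κ) (c : κ → ℝ)
    (ℓ : κ → E →ₗ[ℝ] ℝ) (hc : ∀ k ∈ s, 0 ≤ c k)
    (hpos : ∀ v, 0 < ∑ k ∈ s, c k * Real.exp (ℓ k v)) :
    ConvexOn ℝ Set.univ fun v => Real.log (∑ k ∈ s, c k * Real.exp (ℓ k v)) := by
  refine ⟨convex_univ, fun v _ w _ a b ha hb hab => ?_⟩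
  set Z := fun v => ∑ k ∈ s, c k * Real.exp (ℓ k v) with hZ
  have hZpos : ∀ v, 0 < Z v := hpos
  have hnorm : ∀ v, ∑ k ∈ s, c k * Real.exp (ℓ k v - Real.log (Z v)) = 1 := fun v => by
    simp_rw [Real.exp_sub, Real.exp_log (hZpos v), ← mul_div_assoc, ← Finset.sum_div]
    exact div_self (hpos v).ne'
  -- After normalizing both sums to `1`, convexity of `exp` can be applied term by term.
  have key : Z (a • v + b • w) * Real.exp (-(a * Real.log (Z v) + b * Real.log (Z w))) ≤ 1 := by
    calc _ = ∑ k ∈ s, c k * Real.exp (a • (ℓ k v - Real.log (Z v)) +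
              b • (ℓ k w - Real.log (Z w))) := by
            simp only [hZ, Finset.sum_mul, mul_assoc, ← Real.exp_add]
            refine Finset.sum_congr rfl fun k _ => ?_
            congr 2
            simp only [map_add, map_smul, smul_eq_mul]
            ring
      _ ≤ ∑ k ∈ s, c k * (a • Real.exp (ℓ k v - Real.log (Z v)) +
              b • Real.exp (ℓ k w - Real.log (Z w))) :=
            Finset.sum_le_sum fun k hk => mul_le_mul_of_nonneg_left
              (convexOn_exp.2 (Set.mem_univ _) (Set.mem_univ _) ha hb hab) (hc k hk)
      _ = a * ∑ k ∈ s, c k * Real.exp (ℓ k v - Real.log (Z v)) +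
            b * ∑ k ∈ s, c k * Real.exp (ℓ k w - Real.log (Z w)) := by
            simp only [Finset.mul_sum, ← Finset.sum_add_distrib, smul_eq_mul]
            refine Finset.sum_congr rfl fun k _ => by ring
      _ = 1 := by rw [hnorm, hnorm, mul_one, mul_one, hab]
  rw [Real.exp_neg, ← div_eq_mul_inv, div_le_one (Real.exp_pos _)] at key
  exact (Real.log_le_iff_le_exp (hpos _)).2 key

namespace CMESP

variable {n m : ℕ}

/-! ### The matrix `FBQP` -/

lemma FBQP_eq (C : Matrix (Fin n) (Fin n) ℝ) (Υ : Fin n → ℝ) (p : (Fin n → ℝ) × SymMat n) :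
    FBQP C Υ p = diagonal Υ * (C ⊙ (p.2 : Matrix (Fin n) (Fin n) ℝ)) * diagonal Υ +
      diagonal (fun i => 1 - p.1 i) := by
  ext i j
  simp only [FBQP, Matrix.add_apply, hadamard_apply, mul_diagonal, diagonal_mul]
  ring

lemma FBQP_apply (C : Matrix (Fin n) (Fin n) ℝ) (Υ : Fin n → ℝ) (p : (Fin n → ℝ) × SymMat n)
    (i j : Fin n) :
    FBQP C Υ p i j = Υ i * C i j * Υ j * (p.2 : Matrix (Fin n) (Fin n) ℝ) i j +
      if i = j then 1 - p.1 i else 0 := by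
  simp [FBQP, diagonal_apply, mul_diagonal, diagonal_mul]

lemma isHermitian_FBQP {C : Matrix (Fin n) (Fin n) ℝ} (hC : C.IsHermitian) (Υ : Fin n → ℝ)
    (p : (Fin n → ℝ) × SymMat n) : (FBQP C Υ p).IsHermitian := by
  refine IsHermitian.ext fun i j => ?_
  have h1 : C j i = C i j := by simpa using hC.apply i j
  have h2 : (p.2 : Matrix (Fin n) (Fin n) ℝ) j i = (p.2 : Matrix (Fin n) (Fin n) ℝ) i j :=
    IsSymm.apply p.2.2 i j
  have h3 : (if j = i then 1 - p.1 j else 0) = if i = j then 1 - p.1 i else 0 := by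
    by_cases h : i = j
    · simp [h]
    · simp [h, Ne.symm h]
  rw [star_trivial, FBQP_apply, FBQP_apply, h1, h2, h3]
  ring

lemma dotProduct_FBQP_mulVec (C : Matrix (Fin n) (Fin n) ℝ) (Υ : Fin n → ℝ)
    (p : (Fin n → ℝ) × SymMat n) (v : Fin n → ℝ) :
    v ⬝ᵥ FBQP C Υ p *ᵥ v =
      (Υ * v) ⬝ᵥ (C ⊙ (p.2 : Matrix (Fin n) (Fin n) ℝ)) *ᵥ (Υ * v) +
        ∑ i, (1 - p.1 i) * v i ^ 2 := by
  have h : diagonal Υ *ᵥ v = Υ * v := by ext i; simp [mulVec_diagonal]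
  have h' : v ᵥ* diagonal Υ = Υ * v := by ext i; simp [vecMul_diagonal, mul_comm]
  rw [FBQP_eq, add_mulVec, dotProduct_add, ← mulVec_mulVec, ← mulVec_mulVec, dotProduct_mulVec v,
    h, h']
  congr 1
  refine Finset.sum_congr rfl fun i _ => ?_
  rw [mulVec_diagonal]
  ring

lemma posSemidef_FBQP {C : Matrix (Fin n) (Fin n) ℝ} (hC : C.PosSemidef) (Υ : Fin n → ℝ)
    {p : (Fin n → ℝ) × SymMat n} (hx : ∀ i, p.1 i ≤ 1)
    (hX : (p.2 : Matrix (Fin n) (Fin n) ℝ).PosSemidef) : (FBQP C Υ p).PosSemidef := by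
  refine .of_dotProduct_mulVec_nonneg (isHermitian_FBQP hC.1 Υ p) fun v => ?_
  rw [star_trivial, dotProduct_FBQP_mulVec]
  exact add_nonneg ((hC.hadamard hX).zero_le_dotProduct_mulVec _)
    (Finset.sum_nonneg fun i _ => mul_nonneg (sub_nonneg.2 (hx i)) (sq_nonneg _))

/-- Membership in the domain does not depend on the scaling: both terms of the quadratic form are
nonnegative, and rescaling `v` makes the first term for `Υ'` equal to the one for `Υ` without
changing whether the second vanishes. -/
lemma mem_domBQP_of_mem {C : Matrix (Fin n) (Fin n) ℝ} (hC : C.PosSemidef) {Υ Υ' : Fin n → ℝ}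
    (hΥ : ∀ i, 0 < Υ i) (hΥ' : ∀ i, 0 < Υ' i) {p : (Fin n → ℝ) × SymMat n}
    (hp : p ∈ domBQP C Υ) (hx : ∀ i, p.1 i ≤ 1)
    (hX : (p.2 : Matrix (Fin n) (Fin n) ℝ).PosSemidef) : p ∈ domBQP C Υ' := by
  refine PosDef.of_dotProduct_mulVec_pos (isHermitian_FBQP hC.1 Υ' p) fun v hv => ?_
  have hs : ∀ w : Fin n → ℝ, ∀ i ∈ Finset.univ, 0 ≤ (1 - p.1 i) * w i ^ 2 :=
    fun w i _ => mul_nonneg (sub_nonneg.2 (hx i)) (sq_nonneg _)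
  rw [star_trivial]
  refine lt_of_le_of_ne ((posSemidef_FBQP hC Υ' hx hX).zero_le_dotProduct_mulVec v) fun h0 => ?_
  rw [dotProduct_FBQP_mulVec] at h0
  have h1 := (hC.hadamard hX).zero_le_dotProduct_mulVec (Υ' * v)
  have h2 := Finset.sum_nonneg (hs v)
  have h3 : ∑ i, (1 - p.1 i) * v i ^ 2 = 0 := by linarith
  have h4 := (Finset.sum_eq_zero_iff_of_nonneg (hs v)).1 h3
  set w : Fin n → ℝ := fun i => Υ' i * v i / Υ i with hw
  have hΥw : Υ * w = Υ' * v := by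
    ext i
    simp only [hw, Pi.mul_apply]
    field_simp [(hΥ i).ne']
  have hw0 : w ≠ 0 := by
    rintro h
    refine hv (funext fun i => ?_)
    have := congrFun hΥw i
    simpa [h, (hΥ' i).ne'] using this.symm
  have h5 : ∑ i, (1 - p.1 i) * w i ^ 2 = 0 := by
    refine Finset.sum_eq_zero fun i hi => ?_
    rcases mul_eq_zero.1 (h4 i hi) with h | h
    · simp [h]
    · simp [hw, pow_eq_zero_iff two_ne_zero |>.1 h]
  have h6 := PosDef.dotProduct_mulVec_pos hp hw0
  rw [star_trivial, dotProduct_FBQP_mulVec, hΥw, h5] at h6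
  linarith

/-! ### The feasible set -/

lemma posSemidef_of_mem_P {s : ℕ} {p : (Fin n → ℝ) × SymMat n} (hp : p ∈ P n s) :
    (p.2 : Matrix (Fin n) (Fin n) ℝ).PosSemidef := by
  have h : (vecMulVec p.1 p.1).PosSemidef := by simpa using posSemidef_vecMulVec_self_star p.1
  simpa using hp.1.add h

lemma mem_Icc_of_mem_P {s : ℕ} {p : (Fin n → ℝ) × SymMat n} (hp : p ∈ P n s) (i : Fin n) :
    0 ≤ p.1 i ∧ p.1 i ≤ 1 := by
  have h : 0 ≤ p.1 i - p.1 i * p.1 i := by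
    refine (hp.1.diag_nonneg (i := i)).trans_eq ?_
    rw [Matrix.sub_apply, vecMulVec_apply]
    exact congrArg (· - p.1 i * p.1 i) (congrFun hp.2.1 i)
  constructor <;> nlinarith

@[fun_prop]
lemma continuous_snd_apply (i j : Fin n) :
    Continuous fun p : (Fin n → ℝ) × SymMat n => (p.2 : Matrix (Fin n) (Fin n) ℝ) i j :=
  (continuous_subtype_val.comp continuous_snd).matrix_elem i j

lemma continuous_snd_coe :
    Continuous fun p : (Fin n → ℝ) × SymMat n => (p.2 : Matrix (Fin n) (Fin n) ℝ) :=
  continuous_subtype_val.comp continuous_snd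

lemma isClosed_setOf_posSemidef {ι : Type*} [Fintype ι] :
    IsClosed {M : Matrix ι ι ℝ | M.PosSemidef} := by
  have : {M : Matrix ι ι ℝ | M.PosSemidef} =
      {M | Mᵀ = M} ∩ ⋂ v : ι → ℝ, {M | 0 ≤ v ⬝ᵥ M *ᵥ v} := by
    ext M
    simp [posSemidef_iff_dotProduct_mulVec, IsHermitian, conjTranspose_eq_transpose_of_trivial]
  rw [this]
  refine (isClosed_eq (by fun_prop) (by fun_prop)).inter (isClosed_iInter fun v => ?_)
  exact isClosed_le (by fun_prop) (by fun_prop)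

lemma isClosed_bqpFeasible (s : ℕ) (A : Matrix (Fin m) (Fin n) ℝ) (b : Fin m → ℝ) :
    IsClosed (bqpFeasible s A b) := by
  have h2 := continuous_snd_coe (n := n)
  refine IsClosed.inter (IsClosed.inter ?_ (IsClosed.inter ?_ (IsClosed.inter ?_ ?_))) ?_
  · exact isClosed_setOf_posSemidef.preimage (h2.sub (continuous_fst.matrix_vecMulVec continuous_fst))
  · exact isClosed_eq h2.matrix_diag continuous_fst
  · exact isClosed_eq (by fun_prop) continuous_const
  · exact isClosed_eq (h2.matrix_mulVec continuous_const) (by fun_prop)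
  · exact isClosed_le (continuous_const.matrix_mulVec continuous_fst) continuous_const

lemma isCompact_bqpFeasible (s : ℕ) (A : Matrix (Fin m) (Fin n) ℝ) (b : Fin m → ℝ) :
    IsCompact (bqpFeasible s A b) := by
  have : ProperSpace (SymMat n) := FiniteDimensional.proper_real _
  refine Metric.isCompact_of_isClosed_isBounded (isClosed_bqpFeasible s A b) ?_
  refine (Metric.isBounded_closedBall (x := (0 : (Fin n → ℝ) × SymMat n)) (r := 1)).subset ?_
  rintro p ⟨hp, -⟩
  have hx := mem_Icc_of_mem_P hp
  rw [mem_closedBall_zero_iff, Prod.norm_def, max_le_iff]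
  constructor
  · refine (pi_norm_le_iff_of_nonneg zero_le_one).2 fun i => ?_
    rw [Real.norm_eq_abs, abs_of_nonneg (hx i).1]
    exact (hx i).2
  · refine (Matrix.norm_le_iff zero_le_one).2 fun i j => ?_
    refine (posSemidef_of_mem_P hp).abs_apply_le_one (fun i => ?_) i j
    exact (congrFun hp.2.1 i).trans_le (hx i).2

/-! ### Attainment -/

lemma continuous_FBQP (C : Matrix (Fin n) (Fin n) ℝ) (Υ : Fin n → ℝ) :
    Continuous (FBQP C Υ) := by
  refine continuous_matrix fun i j => ?_
  simp only [FBQP_apply]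
  split_ifs <;> fun_prop

/-- On the feasible set the exponential of the objective extends continuously by `0` outside the
domain, so its maximum over the compact feasible set is a maximum of the objective. -/
lemma exists_isMaxOn_fBQP {C : Matrix (Fin n) (Fin n) ℝ} (hC : C.PosSemidef) (s : ℕ)
    (A : Matrix (Fin m) (Fin n) ℝ) (b : Fin m → ℝ) (Υ : Fin n → ℝ)
    (hne : (bqpFeasible s A b ∩ domBQP C Υ).Nonempty) :
    ∃ p ∈ bqpFeasible s A b ∩ domBQP C Υ,
      ∀ q ∈ bqpFeasible s A b ∩ domBQP C Υ, fBQP C Υ q ≤ fBQP C Υ p := by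
  set h : (Fin n → ℝ) × SymMat n → ℝ :=
    fun p => (FBQP C Υ p).det * Real.exp (-(2 * ∑ i, p.1 i * Real.log (Υ i))) with hh
  have hcont : Continuous h := (continuous_FBQP C Υ).matrix_det.mul (by fun_prop)
  have hexp : ∀ q ∈ domBQP C Υ, h q = Real.exp (fBQP C Υ q) := fun q hq => by
    rw [fBQP, sub_eq_add_neg, Real.exp_add, Real.exp_log (PosDef.det_pos hq)]
  obtain ⟨p, hp, hmax⟩ := (isCompact_bqpFeasible s A b).exists_isMaxOn
    (hne.mono Set.inter_subset_left) hcont.continuousOn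
  obtain ⟨q, hq⟩ := hne
  have hpos : 0 < h p := (hexp q hq.2 ▸ Real.exp_pos _).trans_le (hmax hq.1)
  have hdet : 0 < (FBQP C Υ p).det := pos_of_mul_pos_left hpos (Real.exp_pos _).le
  have hpdom : p ∈ domBQP C Υ := (posSemidef_FBQP hC Υ (fun i => (mem_Icc_of_mem_P hp.1 i).2)
    (posSemidef_of_mem_P hp.1)).posDef_iff_det_ne_zero.2 hdet.ne'
  refine ⟨p, ⟨hp, hpdom⟩, fun r hr => ?_⟩
  rw [← Real.exp_le_exp, ← hexp r hr.2, ← hexp p hpdom]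
  exact hmax hr.1

lemma zBQP_eq_of_forall_le {C : Matrix (Fin n) (Fin n) ℝ} {s : ℕ}
    {A : Matrix (Fin m) (Fin n) ℝ} {b : Fin m → ℝ} {Υ : Fin n → ℝ} {p : (Fin n → ℝ) × SymMat n}
    (hp : p ∈ bqpFeasible s A b ∩ domBQP C Υ)
    (h : ∀ q ∈ bqpFeasible s A b ∩ domBQP C Υ, fBQP C Υ q ≤ fBQP C Υ p) :
    zBQP C s A b Υ = ((fBQP C Υ p : ℝ) : EReal) :=
  le_antisymm (iSup₂_le fun q hq => EReal.coe_le_coe_iff.2 (h q hq))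
    (le_iSup₂ (f := fun q _ => ((fBQP C Υ q : ℝ) : EReal)) p hp)

/-! ### The relaxation bound -/

/-- A binary point `x` is lifted to the rank-one matrix `x xᵀ`; the lifted point has the same
objective value, for every scaling. -/
lemma z_le_zBQP {C : Matrix (Fin n) (Fin n) ℝ} (hC : C.PosSemidef) (s : ℕ)
    (A : Matrix (Fin m) (Fin n) ℝ) (b : Fin m → ℝ) {Υ : Fin n → ℝ} (hΥ : ∀ i, 0 < Υ i) :
    z C s A b ≤ zBQP C s A b Υ := by
  refine iSup₂_le fun x hx => ?_
  obtain ⟨⟨hx01, hxs, hxA⟩, hpd⟩ := hx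
  have hone : ∀ i ∈ supp x, x i = 1 := fun i hi => by
    have : x i ≠ 0 := by simpa [supp] using hi
    exact (hx01 i).resolve_left this
  have hzero : ∀ i ∉ supp x, x i = 0 := fun i hi => by simpa [supp] using hi
  set p : (Fin n → ℝ) × SymMat n := (x, ⟨vecMulVec x x, transpose_vecMulVec x x⟩) with hpdef
  have hpP : p ∈ P n s := by
    refine ⟨by simpa [hpdef] using PosSemidef.zero, ?_, hxs, ?_⟩
    · ext i
      rcases hx01 i with h | h <;> simp [hpdef, vecMulVec_apply, h]
    · ext i
      simp [hpdef, vecMulVec_apply, mulVec, dotProduct, ← Finset.mul_sum, hxs, mul_comm]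
  have hdet : (FBQP C Υ p).det = (principal C (supp x)).det * ∏ i ∈ supp x, Υ i ^ 2 := by
    rw [det_eq_of_rows_diagonal _ (fun i => 1 - x i) (supp x) fun i hi j => by
      simp [FBQP_apply, hpdef, vecMulVec_apply, hzero i hi, diagonal_apply]]
    have e1 : ∏ i ∈ (supp x)ᶜ, (1 - x i) = 1 :=
      Finset.prod_eq_one fun i hi => by simp [hzero i (Finset.mem_compl.1 hi)]
    have e2 : (FBQP C Υ p).submatrix (Subtype.val : supp x → Fin n) Subtype.val =
        diagonal (fun i : supp x => Υ i) * principal C (supp x) *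
          diagonal (fun i : supp x => Υ i) := by
      ext i j
      simp [FBQP_apply, hpdef, vecMulVec_apply, hone i i.2, hone j j.2, principal, mul_diagonal,
        diagonal_mul]
    rw [e1, e2, det_mul, det_mul, det_diagonal, mul_one, Finset.prod_pow,
      Finset.prod_coe_sort (supp x) Υ]
    ring
  have hprod : 0 < ∏ i ∈ supp x, Υ i ^ 2 := Finset.prod_pos fun i _ => pow_pos (hΥ i) 2
  have hdom : p ∈ domBQP C Υ :=
    (posSemidef_FBQP hC Υ (fun i => (mem_Icc_of_mem_P hpP i).2)
      (posSemidef_of_mem_P hpP)).posDef_iff_det_ne_zero.2 <| by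
        rw [hdet]; exact (mul_pos hpd.det_pos hprod).ne'
  have hval : fBQP C Υ p = Real.log (principal C (supp x)).det := by
    have e3 : ∑ i, p.1 i * Real.log (Υ i) = ∑ i ∈ supp x, Real.log (Υ i) := by
      rw [← Finset.sum_subset (Finset.subset_univ (supp x)) fun i _ hi => by
        simp [hpdef, hzero i hi]]
      exact Finset.sum_congr rfl fun i hi => by simp [hpdef, hone i hi]
    rw [fBQP, hdet, Real.log_mul hpd.det_pos.ne' hprod.ne',
      Real.log_prod fun i _ => (pow_pos (hΥ i) 2).ne', e3]
    simp [Real.log_pow, Finset.mul_sum]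
  rw [← hval]
  exact le_iSup₂ (f := fun q _ => ((fBQP C Υ q : ℝ) : EReal)) p ⟨⟨hpP, hxA⟩, hdom⟩

/-! ### Concavity and smoothness in the matrix variables -/

lemma FBQP_convex_comb (C : Matrix (Fin n) (Fin n) ℝ) (Υ : Fin n → ℝ)
    (p q : (Fin n → ℝ) × SymMat n) {a b : ℝ} (hab : a + b = 1) :
    FBQP C Υ (a • p + b • q) = a • FBQP C Υ p + b • FBQP C Υ q := by
  ext i j
  simp only [FBQP_apply, Matrix.add_apply, Matrix.smul_apply, Prod.fst_add, Prod.snd_add,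
    Prod.smul_fst, Prod.smul_snd, Submodule.coe_add, Submodule.coe_smul, Pi.add_apply,
    Pi.smul_apply, smul_eq_mul]
  split_ifs
  · linear_combination -hab
  · ring

lemma concaveOn_fBQP (C : Matrix (Fin n) (Fin n) ℝ) (Υ : Fin n → ℝ) :
    ConcaveOn ℝ (domBQP C Υ) (fBQP C Υ) := by
  have hF := FBQP_convex_comb C Υ
  refine ⟨fun p hp q hq a b ha hb hab => ?_, fun p hp q hq a b ha hb hab => ?_⟩
  · change (FBQP C Υ (a • p + b • q)).PosDef
    rw [hF p q hab]
    exact concaveOn_log_det.1 hp hq ha hb hab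
  · have h := concaveOn_log_det.2 hp hq ha hb hab
    simp only [← hF p q hab, smul_eq_mul] at h
    simp only [fBQP, smul_eq_mul, Prod.fst_add, Prod.smul_fst, Pi.add_apply, Pi.smul_apply,
      add_mul, Finset.sum_add_distrib, mul_assoc, ← Finset.mul_sum]
    linarith

lemma contDiff_FBQP_apply (C : Matrix (Fin n) (Fin n) ℝ) (i j : Fin n) :
    ContDiff ℝ 1 fun q : ((Fin n → ℝ) × SymMat n) × (Fin n → ℝ) => FBQP C q.2 q.1 i j := by
  have hX : ContDiff ℝ 1 fun q : ((Fin n → ℝ) × SymMat n) × (Fin n → ℝ) =>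
      (q.1.2 : Matrix (Fin n) (Fin n) ℝ) i j :=
    (contDiff_apply_apply ℝ ℝ i j).comp
      ((SymMat n).subtypeL.contDiff.comp (contDiff_snd.comp contDiff_fst))
  have hx : ContDiff ℝ 1 fun q : ((Fin n → ℝ) × SymMat n) × (Fin n → ℝ) => q.1.1 i :=
    (contDiff_apply ℝ ℝ i).comp (contDiff_fst.comp contDiff_fst)
  have hΥ : ∀ k, ContDiff ℝ 1 fun q : ((Fin n → ℝ) × SymMat n) × (Fin n → ℝ) => q.2 k :=
    fun k => (contDiff_apply ℝ ℝ k).comp contDiff_snd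
  simp only [FBQP_apply]
  refine (((hΥ i).mul contDiff_const).mul (hΥ j)).mul hX |>.add ?_
  split_ifs
  · exact contDiff_const.sub hx
  · exact contDiff_const

lemma contDiff_det_FBQP (C : Matrix (Fin n) (Fin n) ℝ) :
    ContDiff ℝ 1 fun q : ((Fin n → ℝ) × SymMat n) × (Fin n → ℝ) => (FBQP C q.2 q.1).det := by
  simp only [det_apply']
  exact ContDiff.sum fun σ _ => contDiff_const.mul <|
    contDiff_prod fun i _ => contDiff_FBQP_apply C (σ i) i

lemma contDiffOn_fBQP (C : Matrix (Fin n) (Fin n) ℝ) :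
    ContDiffOn ℝ 1 (fun q : ((Fin n → ℝ) × SymMat n) × (Fin n → ℝ) => fBQP C q.2 q.1)
      {q | (∀ i, 0 < q.2 i) ∧ q.1 ∈ domBQP C q.2} := by
  refine ((contDiff_det_FBQP C).contDiffOn.log fun q hq => (PosDef.det_pos hq.2).ne').sub ?_
  refine contDiffOn_const.mul <| ContDiffOn.sum fun i _ => ?_
  refine ContDiffOn.mul ((contDiff_apply ℝ ℝ i).comp
    (contDiff_fst.comp contDiff_fst)).contDiffOn ?_
  exact ((contDiff_apply ℝ ℝ i).comp contDiff_snd).contDiffOn.log fun q hq => (hq.1 i).ne'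

lemma isOpen_setOf_forall_sphere_pos {ι : Type*} [Fintype ι] :
    IsOpen {M : Matrix ι ι ℝ | ∀ v ∈ Metric.sphere (0 : ι → ℝ) 1, 0 < v ⬝ᵥ M *ᵥ v} := by
  refine isOpen_iff_eventually.2 fun M hM => ?_
  refine (isCompact_sphere (0 : ι → ℝ) 1).eventually_forall_of_forall_eventually fun v hv => ?_
  have hcont : Continuous fun z : Matrix ι ι ℝ × (ι → ℝ) => z.2 ⬝ᵥ z.1 *ᵥ z.2 :=
    continuous_snd.dotProduct (continuous_fst.matrix_mulVec continuous_snd)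
  exact hcont.continuousAt.eventually (lt_mem_nhds (hM v hv))

lemma posDef_iff_forall_sphere_pos {ι : Type*} [Fintype ι] {M : Matrix ι ι ℝ}
    (hM : M.IsHermitian) :
    M.PosDef ↔ ∀ v ∈ Metric.sphere (0 : ι → ℝ) 1, 0 < v ⬝ᵥ M *ᵥ v := by
  refine ⟨fun h v hv => by
    simpa using h.dotProduct_mulVec_pos (ne_zero_of_mem_unit_sphere ⟨v, hv⟩), fun h => ?_⟩
  refine .of_dotProduct_mulVec_pos hM fun v hv => ?_
  have hnv : 0 < ‖v‖ := norm_pos_iff.2 hv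
  have := h (‖v‖⁻¹ • v) (by simp [norm_smul, hnv.ne'])
  rw [mulVec_smul, dotProduct_smul, smul_dotProduct, smul_eq_mul, smul_eq_mul] at this
  simpa [hnv] using this

lemma isOpen_setOf_mem_domBQP {C : Matrix (Fin n) (Fin n) ℝ} (hC : C.IsHermitian) :
    IsOpen {q : ((Fin n → ℝ) × SymMat n) × (Fin n → ℝ) |
      (∀ i, 0 < q.2 i) ∧ q.1 ∈ domBQP C q.2} := by
  have hcont : Continuous fun q : ((Fin n → ℝ) × SymMat n) × (Fin n → ℝ) => FBQP C q.2 q.1 :=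
    continuous_matrix fun i j => (contDiff_FBQP_apply C i j).continuous
  have h1 : IsOpen {q : ((Fin n → ℝ) × SymMat n) × (Fin n → ℝ) | ∀ i, 0 < q.2 i} := by
    simp only [Set.ofPred_forall]
    exact isOpen_iInter_of_finite fun i => isOpen_lt continuous_const (by fun_prop)
  have h2 : IsOpen {q : ((Fin n → ℝ) × SymMat n) × (Fin n → ℝ) | q.1 ∈ domBQP C q.2} := by
    convert! isOpen_setOf_forall_sphere_pos.preimage hcont using 1
    exact Set.ext fun q => posDef_iff_forall_sphere_pos (isHermitian_FBQP hC q.2 q.1)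
  exact h1.inter h2

/-! ### Convexity in the logarithm of the scaling -/

lemma expVec_pos (ψ : Fin n → ℝ) (i : Fin n) : 0 < expVec ψ i := Real.exp_pos _

/-- The expansion of `det F` over subsets, as a combination of exponentials of linear functionals
of `ψ = log Υ`. -/
lemma det_FBQP_expVec (C : Matrix (Fin n) (Fin n) ℝ) (p : (Fin n → ℝ) × SymMat n)
    (ψ : Fin n → ℝ) :
    (FBQP C (expVec ψ) p).det = ∑ S : Finset (Fin n),
      ((principal (C ⊙ (p.2 : Matrix (Fin n) (Fin n) ℝ)) S).det * ∏ i ∈ Sᶜ, (1 - p.1 i)) *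
        Real.exp ((∑ i ∈ S, (2 : ℝ) • LinearMap.proj (R := ℝ) (φ := fun _ : Fin n => ℝ) i) ψ) := by
  rw [FBQP_eq, det_add_diagonal]
  refine Finset.sum_congr rfl fun S _ => ?_
  set M := C ⊙ (p.2 : Matrix (Fin n) (Fin n) ℝ)
  have e : (diagonal (expVec ψ) * M * diagonal (expVec ψ)).submatrix
      (Subtype.val : S → Fin n) Subtype.val =
      diagonal (fun i : S => expVec ψ i) * principal M S * diagonal (fun i : S => expVec ψ i) := by
    ext i j
    simp [principal, mul_diagonal, diagonal_mul]
  have e' : Real.exp ((∑ i ∈ S, (2 : ℝ) • LinearMap.proj (R := ℝ) (φ := fun _ : Fin n => ℝ) i) ψ) =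
      (∏ i ∈ S, expVec ψ i) * ∏ i ∈ S, expVec ψ i := by
    rw [← Finset.prod_mul_distrib]
    simp [expVec, ← Real.exp_add, Real.exp_sum, two_mul]
  rw [e, det_mul, det_mul, det_diagonal, Finset.prod_coe_sort S (expVec ψ), e']
  ring

lemma convexOn_fBQP_expVec {C : Matrix (Fin n) (Fin n) ℝ} (hC : C.PosSemidef)
    {p : (Fin n → ℝ) × SymMat n} (hp : ∀ ψ, p ∈ domBQP C (expVec ψ)) (hx : ∀ i, p.1 i ≤ 1)
    (hX : (p.2 : Matrix (Fin n) (Fin n) ℝ).PosSemidef) :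
    ConvexOn ℝ Set.univ fun ψ : Fin n → ℝ => fBQP C (expVec ψ) p := by
  have h := convexOn_log_sum_exp (Finset.univ : Finset (Finset (Fin n)))
    (fun S => (principal (C ⊙ (p.2 : Matrix (Fin n) (Fin n) ℝ)) S).det * ∏ i ∈ Sᶜ, (1 - p.1 i))
    (fun S => ∑ i ∈ S, (2 : ℝ) • LinearMap.proj (R := ℝ) (φ := fun _ : Fin n => ℝ) i)
    (fun S _ => mul_nonneg ((hC.hadamard hX).submatrix _).det_nonneg
      (Finset.prod_nonneg fun i _ => sub_nonneg.2 (hx i)))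
    (fun ψ => det_FBQP_expVec C p ψ ▸ (hp ψ).det_pos)
  simp only [← det_FBQP_expVec] at h
  have hlin := LinearMap.concaveOn
    (∑ i, (2 * p.1 i) • LinearMap.proj (R := ℝ) (φ := fun _ : Fin n => ℝ) i) convex_univ
  refine (h.sub hlin).congr fun ψ _ => ?_
  simp [fBQP, expVec, Finset.mul_sum, mul_assoc]

lemma mem_domBQP_expVec {C : Matrix (Fin n) (Fin n) ℝ} (hC : C.PosSemidef) {s : ℕ}
    {A : Matrix (Fin m) (Fin n) ℝ} {b : Fin m → ℝ} {ψ : Fin n → ℝ} {p : (Fin n → ℝ) × SymMat n}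
    (hp : p ∈ bqpFeasible s A b ∩ domBQP C (expVec ψ)) (φ : Fin n → ℝ) :
    p ∈ domBQP C (expVec φ) :=
  mem_domBQP_of_mem hC (expVec_pos ψ) (expVec_pos φ) hp.2 (fun i => (mem_Icc_of_mem_P hp.1.1 i).2)
    (posSemidef_of_mem_P hp.1.1)

/-- The points contributing to the bound are the same for every scaling, so the bound is a
pointwise maximum of convex functions of `log Υ` over a fixed set. -/
lemma zBQP_expVec_eq_bot_or_convexOn {C : Matrix (Fin n) (Fin n) ℝ} (hC : C.PosSemidef) (s : ℕ)
    (A : Matrix (Fin m) (Fin n) ℝ) (b : Fin m → ℝ) :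
    (∀ ψ : Fin n → ℝ, zBQP C s A b (expVec ψ) = ⊥) ∨
      ∃ g : (Fin n → ℝ) → ℝ, (∀ ψ : Fin n → ℝ, zBQP C s A b (expVec ψ) = ((g ψ : ℝ) : EReal)) ∧
        ConvexOn ℝ Set.univ g := by
  by_cases hne : ∃ ψ : Fin n → ℝ, (bqpFeasible s A b ∩ domBQP C (expVec ψ)).Nonempty
  · right
    obtain ⟨ψ₀, p₀, hp₀⟩ := hne
    choose p hp hmax using fun ψ => exists_isMaxOn_fBQP hC s A b (expVec ψ)
      ⟨p₀, hp₀.1, mem_domBQP_expVec hC hp₀ ψ⟩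
    refine ⟨fun ψ => fBQP C (expVec ψ) (p ψ), fun ψ => zBQP_eq_of_forall_le (hp ψ) (hmax ψ),
      convex_univ, fun ψ _ φ _ a c ha hc hac => ?_⟩
    set q := p (a • ψ + c • φ) with hq
    have hqdom := mem_domBQP_expVec hC (hp (a • ψ + c • φ))
    have hqF := (hp (a • ψ + c • φ)).1
    calc fBQP C (expVec (a • ψ + c • φ)) q
        ≤ a • fBQP C (expVec ψ) q + c • fBQP C (expVec φ) q :=
          (convexOn_fBQP_expVec hC hqdom (fun i => (mem_Icc_of_mem_P hqF.1 i).2)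
            (posSemidef_of_mem_P hqF.1)).2 (Set.mem_univ _) (Set.mem_univ _) ha hc hac
      _ ≤ a • fBQP C (expVec ψ) (p ψ) + c • fBQP C (expVec φ) (p φ) :=
          add_le_add (smul_le_smul_of_nonneg_left (hmax ψ q ⟨hqF, hqdom ψ⟩) ha)
            (smul_le_smul_of_nonneg_left (hmax φ q ⟨hqF, hqdom φ⟩) hc)
  · left
    push Not at hne
    intro ψ
    simp [zBQP, hne ψ]

end CMESP

theorem theorem1 {n m : ℕ} (s : ℕ) (hs : 0 < s) (hsn : s < n)
    (C : Matrix (Fin n) (Fin n) ℝ) (hC : C.PosSemidef)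
    (A : Matrix (Fin m) (Fin n) ℝ) (b : Fin m → ℝ) :
    -- the maximum defining the bound is attained as soon as some feasible point has a finite value
    (∀ Υ : Fin n → ℝ, (∀ i, 0 < Υ i) →
      (CMESP.bqpFeasible s A b ∩ CMESP.domBQP C Υ).Nonempty →
      ∃ p ∈ CMESP.bqpFeasible s A b ∩ CMESP.domBQP C Υ,
        CMESP.zBQP C s A b Υ = ((CMESP.fBQP C Υ p : ℝ) : EReal)) ∧
    -- (i) valid upper bound
    (∀ Υ : Fin n → ℝ, (∀ i, 0 < Υ i) → CMESP.z C s A b ≤ CMESP.zBQP C s A b Υ) ∧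
    -- (ii) concavity in (x, X)
    (∀ Υ : Fin n → ℝ, (∀ i, 0 < Υ i) →
      ConcaveOn ℝ (CMESP.domBQP C Υ) (CMESP.fBQP C Υ)) ∧
    -- (ii) continuous differentiability in (x, X, Υ), on an open set of triples
    (IsOpen {q : ((Fin n → ℝ) × CMESP.SymMat n) × (Fin n → ℝ) |
        (∀ i, 0 < q.2 i) ∧ q.1 ∈ CMESP.domBQP C q.2} ∧
      ContDiffOn ℝ 1
        (fun q : ((Fin n → ℝ) × CMESP.SymMat n) × (Fin n → ℝ) => CMESP.fBQP C q.2 q.1)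
        {q | (∀ i, 0 < q.2 i) ∧ q.1 ∈ CMESP.domBQP C q.2}) ∧
    -- (iii) convexity of f in log Υ, for fixed (x, X)
    (∀ Υ : Fin n → ℝ, (∀ i, 0 < Υ i) → ∀ p ∈ CMESP.domBQP C Υ,
      (∀ i, 0 ≤ p.1 i ∧ p.1 i ≤ 1) → (p.2 : Matrix (Fin n) (Fin n) ℝ).PosSemidef →
      (∀ ψ : Fin n → ℝ, p ∈ CMESP.domBQP C (CMESP.expVec ψ)) ∧
      ConvexOn ℝ Set.univ (fun ψ : Fin n → ℝ => CMESP.fBQP C (CMESP.expVec ψ) p)) ∧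
    -- (iii) convexity of the bound in log Υ
    ((∀ ψ : Fin n → ℝ, CMESP.zBQP C s A b (CMESP.expVec ψ) = ⊥) ∨
      ∃ g : (Fin n → ℝ) → ℝ,
        (∀ ψ : Fin n → ℝ, CMESP.zBQP C s A b (CMESP.expVec ψ) = ((g ψ : ℝ) : EReal)) ∧
        ConvexOn ℝ Set.univ g) := by
  refine ⟨fun Υ _ hne => ?_, fun Υ hΥ => CMESP.z_le_zBQP hC s A b hΥ,
    fun Υ _ => CMESP.concaveOn_fBQP C Υ,
    ⟨CMESP.isOpen_setOf_mem_domBQP hC.1, CMESP.contDiffOn_fBQP C⟩, fun Υ hΥ p hp hx hX => ?_,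
    CMESP.zBQP_expVec_eq_bot_or_convexOn hC s A b⟩
  · obtain ⟨p, hp, hmax⟩ := CMESP.exists_isMaxOn_fBQP hC s A b Υ hne
    exact ⟨p, hp, CMESP.zBQP_eq_of_forall_le hp hmax⟩
  · have hdom : ∀ ψ, p ∈ CMESP.domBQP C (CMESP.expVec ψ) := fun ψ =>
      CMESP.mem_domBQP_of_mem hC hΥ (CMESP.expVec_pos ψ) hp (fun i => (hx i).2) hX
    exact ⟨hdom, CMESP.convexOn_fBQP_expVec hC hdom (fun i => (hx i).2) hX⟩
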